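/- Let $0<q<1$. For $x\in\mathbb C$ put $(x;q)_n=\prod_{k=0}^{n-1}(1-xq^k)$ for integers $n\ge 0$ and $(x;q)_\infty=\prod_{k=0}^{\infty}(1-xq^k)$; write $(x_1,\dots,x_m;q)_n=(x_1;q)_n\cdots(x_m;q)_n$, also for $n=\infty$, and $${}_3\phi_2\left({x_1,x_2,x_3\atop y_1,y_2};q,z\right)=\sum_{k=0}^\infty\frac{(x_1,x_2,x_3;q)_k\,z^k}{(q,y_1,y_2;q)_k}.$$ Let $a,b,c,d,r,u,v$ be complex numbers with $\max\{|a|,|b|,|c|,|d|,|r|\}<1$ and $u,v\neq 0$, and let $\alpha=a^2bcdr/q$. Assume that $\alpha\ne 1$ and that $\alpha uq^k\neq 1$ and $\alpha vq^k\ne 1$ for all integers $k\ge 0$. Then all the series below converge absolutely, and $$\sum_{n=0}^\infty \frac{(\alpha uv/q, ab, ac, ad, ar; q)_n\, (bcdr)^n}{(q, \alpha u, \alpha v, abcd, abcr; q)_n}\, {}_3\phi_2\left({abq^n, acq^n, bc\atop abcdq^n, abcrq^n}; q, dr\right)$$ $$=\frac{(abdr, acdr; q)_\infty}{(dr, q\alpha;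 q)_\infty} \sum_{n=0}^\infty \frac{(1-\alpha q^{2n})(\alpha, ab, ac, ad, ar, q/u, q/v; q)_n}{(1-\alpha)(q, abcd, abcr, abdr, acdr, \alpha u, \alpha v; q)_n} \left(-\frac{\alpha bcdruv}{q}\right)^n q^{n(n-1)/2}.$$ -/

import Mathlib

noncomputable section

/-- The finite `q`-shifted factorial `(a; q)_n = ∏_{k=0}^{n-1} (1 - a q^k)`. -/
def qShift (a q : ℂ) (n : ℕ) : ℂ := ∏ k ∈ Finset.range n, (1 - a * q ^ k)

/-- The infinite `q`-shifted factorial `(a; q)_∞ = ∏_{k=0}^∞ (1 - a q^k)`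
(the product converges for `|q| < 1`, see `multipliable_qShiftInf`). -/
def qShiftInf (a q : ℂ) : ℂ := ∏' k : ℕ, (1 - a * q ^ k)

/-- The multiple `q`-shifted factorial `(a_1, ..., a_m; q)_n`. -/
def qShifts {m : ℕ} (a : Fin m → ℂ) (q : ℂ) (n : ℕ) : ℂ := ∏ i, qShift (a i) q n

/-- The multiple infinite `q`-shifted factorial `(a_1, ..., a_m; q)_∞`. -/
def qShiftsInf {m : ℕ} (a : Fin m → ℂ) (q : ℂ) : ℂ := ∏ i, qShiftInf (a i) q

/-- The `n`-th term of the basic hypergeometric series `_{s+1}φ_s(a; b; q, z)`. -/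
def qHypTerm {s : ℕ} (a : Fin (s + 1) → ℂ) (b : Fin s → ℂ) (q z : ℂ) (n : ℕ) : ℂ :=
  qShifts a q n * z ^ n / (qShift q q n * qShifts b q n)

/-- The basic hypergeometric series `_{s+1}φ_s(a_1, ..., a_{s+1}; b_1, ..., b_s; q, z)`. -/
def qHyp {s : ℕ} (a : Fin (s + 1) → ℂ) (b : Fin s → ℂ) (q z : ℂ) : ℂ :=
  ∑' n : ℕ, qHypTerm a b q z n

theorem multipliable_qShiftInf (a q : ℂ) (hq : ‖q‖ < 1) :
    Multipliable fun k : ℕ => 1 - a * q ^ k := by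
  have h : Summable fun k : ℕ => ‖-(a * q ^ k)‖ := by
    simp only [norm_neg, norm_mul, norm_pow]
    exact (summable_geometric_of_lt_one (norm_nonneg q) hq).mul_left _
  simpa [sub_eq_add_neg] using multipliable_one_add_of_summable h

/-- The `n`-th term of the outer sum of the double series, with the inner `_3φ_2` as a factor. -/
def doubleSeriesTerm (q α a b c d r u v : ℂ) (n : ℕ) : ℂ :=
  qShifts ![α * u * v / q, a * b, a * c, a * d, a * r] q n * (b * c * d * r) ^ n
    / qShifts ![q, α * u, α * v, a * b * c * d, a * b * c * r] q n
    * qHyp ![a * b * q ^ n, a * c * q ^ n, b * c]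
        ![a * b * c * d * q ^ n, a * b * c * r * q ^ n] q (d * r)

/-- The `n`-th term of the well-poised single series. -/
def singleSeriesTerm (q α a b c d r u v : ℂ) (n : ℕ) : ℂ :=
  (1 - α * q ^ (2 * n)) * qShifts ![α, a * b, a * c, a * d, a * r, q / u, q / v] q n
    / ((1 - α) * qShifts ![q, a * b * c * d, a * b * c * r, a * b * d * r, a * c * d * r,
        α * u, α * v] q n)
    * (-(α * (b * c * d * r) * u * v / q)) ^ n * q ^ (n * (n - 1) / 2)

end

open Filter Topology

noncomputable section

/-! The identity is Bailey's transform: one absolutely convergent triple series, `tripleTerm`, with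
indices k, m, j and n = k + m, is summed in two ways. By Rogers' sum `terminating_sixPhiFive`, the
part of the n-th outer coefficient containing u and v, namely (αuv/q)_n / ((q)_n (αu)_n (αv)_n), is
the sum over k ≤ n of `wellPoisedTerm` divided by (q)_{n-k} (αq)_{n+k}. Summing over j and then over
k + m = n therefore gives the double series. For fixed k, u and v enter only through the factor
`wellPoisedTerm`, and what remains is the double series `innerTerm` in m and j with a replaced by a
q^k. Along m + j = const the q-Saalschütz sum reduces it to a ₂φ₁, which the q-Gauss sum evaluates
(`tsum_innerTerm`). This gives the single series with its infinite products. The interchange rests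
on `summable_tripleTerm`. The two finite sums follow from telescoping certificates, the q-Gauss sum
from a relation between the arguments z and zq. -/

/-! ### Shifted factorials: splitting, nonvanishing, limits. -/

theorem qShift_zero (x q : ℂ) : qShift x q 0 = 1 := by simp [qShift]

theorem qShift_succ (x q : ℂ) (n : ℕ) : qShift x q (n + 1) = qShift x q n * (1 - x * q ^ n) :=
  Finset.prod_range_succ _ _

theorem qShift_add (x q : ℂ) (n m : ℕ) :
    qShift x q (n + m) = qShift x q n * qShift (x * q ^ n) q m := by
  simp only [qShift, Finset.prod_range_add, pow_add, mul_assoc]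

theorem qShift_ne_zero {x q : ℂ} (h : ∀ k : ℕ, x * q ^ k ≠ 1) (n : ℕ) : qShift x q n ≠ 0 :=
  Finset.prod_ne_zero_iff.2 fun k _ => sub_ne_zero.2 (h k).symm

theorem mul_pow_ne_one_of_norm_lt_one {x q : ℂ} (hq : ‖q‖ < 1) (hx : ‖x‖ < 1) (k : ℕ) :
    x * q ^ k ≠ 1 := by
  intro h
  have h1 : ‖x * q ^ k‖ = 1 := by rw [h, norm_one]
  have h2 : ‖q‖ ^ k ≤ 1 := pow_le_one₀ (norm_nonneg _) hq.le
  rw [norm_mul, norm_pow] at h1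
  nlinarith [norm_nonneg x, norm_nonneg q]

theorem qShift_ne_zero_of_norm_lt_one {x q : ℂ} (hq : ‖q‖ < 1) (hx : ‖x‖ < 1) (n : ℕ) :
    qShift x q n ≠ 0 :=
  qShift_ne_zero (mul_pow_ne_one_of_norm_lt_one hq hx) n

theorem tendsto_qShift (x : ℂ) {q : ℂ} (hq : ‖q‖ < 1) :
    Tendsto (qShift x q) atTop (𝓝 (qShiftInf x q)) :=
  (multipliable_qShiftInf x q hq).hasProd.tendsto_prod_nat

theorem qShiftInf_ne_zero {x q : ℂ} (hq : ‖q‖ < 1) (h : ∀ k : ℕ, x * q ^ k ≠ 1) :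
    qShiftInf x q ≠ 0 := by
  have hs : Summable fun k : ℕ => ‖-(x * q ^ k)‖ := by
    simp only [norm_neg, norm_mul, norm_pow]
    exact (summable_geometric_of_lt_one (norm_nonneg q) hq).mul_left _
  have := tprod_one_add_ne_zero_of_summable (f := fun k : ℕ => -(x * q ^ k))
    (fun k => by rw [← sub_eq_add_neg]; exact sub_ne_zero.2 (h k).symm) hs
  simpa [qShiftInf, sub_eq_add_neg] using this

theorem qShiftInf_eq_mul (x : ℂ) {q : ℂ} (hq : ‖q‖ < 1) (n : ℕ) :
    qShiftInf x q = qShift x q n * qShiftInf (x * q ^ n) q := by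
  refine tendsto_nhds_unique ((tendsto_add_atTop_iff_nat n).2 (tendsto_qShift x hq)) ?_
  simp only [add_comm _ n, qShift_add]
  exact (tendsto_qShift _ hq).const_mul _

/-! ### Convergence by boundedness: shifted factorials and their reciprocals are bounded, so only
powers matter. -/

/-- A family of complex numbers which is bounded in norm. -/
def IsBoundedFamily {ι : Type*} (f : ι → ℂ) : Prop := ∃ M : ℝ, ∀ i, ‖f i‖ ≤ M

namespace IsBoundedFamily

variable {ι κ : Type*}

theorem comp {f : ι → ℂ} (hf : IsBoundedFamily f) (g : κ → ι) :
    IsBoundedFamily fun i => f (g i) :=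
  let ⟨M, hM⟩ := hf
  ⟨M, fun i => hM (g i)⟩

theorem mul {f g : ι → ℂ} (hf : IsBoundedFamily f) (hg : IsBoundedFamily g) :
    IsBoundedFamily fun i => f i * g i := by
  obtain ⟨M, hM⟩ := hf
  obtain ⟨N, hN⟩ := hg
  refine ⟨M * N, fun i => ?_⟩
  rw [norm_mul]
  exact mul_le_mul (hM i) (hN i) (norm_nonneg _) ((norm_nonneg _).trans (hM i))

theorem const (z : ℂ) : IsBoundedFamily fun _ : ι => z := ⟨‖z‖, fun _ => le_rfl⟩

theorem of_tendsto {f : ℕ → ℂ} {z : ℂ} (h : Tendsto f atTop (𝓝 z)) : IsBoundedFamily f := by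
  obtain ⟨M, hM⟩ := (Metric.isBounded_range_of_tendsto f h).exists_norm_le
  exact ⟨M, fun i => hM _ ⟨i, rfl⟩⟩

theorem summable_mul {f g : ι → ℂ} (hf : IsBoundedFamily f) (hg : Summable g) :
    Summable fun i => f i * g i := by
  obtain ⟨M, hM⟩ := hf
  refine Summable.of_norm_bounded (hg.norm.mul_left M) fun i => ?_
  rw [norm_mul]
  exact mul_le_mul_of_nonneg_right (hM i) (norm_nonneg _)

theorem qShift (x : ℂ) {q : ℂ} (hq : ‖q‖ < 1) : IsBoundedFamily (qShift x q) :=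
  of_tendsto (tendsto_qShift x hq)

theorem inv_qShift {x q : ℂ} (hq : ‖q‖ < 1) (h : ∀ k : ℕ, x * q ^ k ≠ 1) :
    IsBoundedFamily fun n => (_root_.qShift x q n)⁻¹ :=
  of_tendsto ((tendsto_qShift x hq).inv₀ (qShiftInf_ne_zero hq h))

end IsBoundedFamily

/-! ### Terminating sums: q-Saalschütz and Rogers' ₆φ₅. -/

/-- `1 / (q; q)_{n-k}`, read as zero for `k > n`. -/
def invQFact (q : ℂ) (n k : ℕ) : ℂ := if k ≤ n then (qShift q q (n - k))⁻¹ else 0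

theorem invQFact_succ_succ (q : ℂ) (n k : ℕ) : invQFact q (n + 1) (k + 1) = invQFact q n k := by
  simp [invQFact]

/-- `(e; q)_{n-k} / (q; q)_{n-k}`, read as zero for `k > n`. -/
def qBinomCoeff (e q : ℂ) (n k : ℕ) : ℂ :=
  if k ≤ n then qShift e q (n - k) / qShift q q (n - k) else 0

theorem qBinomCoeff_succ_succ (e q : ℂ) (n k : ℕ) :
    qBinomCoeff e q (n + 1) (k + 1) = qBinomCoeff e q n k := by
  simp [qBinomCoeff]

/-- This is the ratio of consecutive coefficients, multiplied by q^k to avoid exponents n - k. In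
this form it survives the cutoff: at k = n + 1 both sides vanish, and beyond it all coefficients are
zero. -/
theorem qBinomCoeff_succ_left (e : ℂ) {q : ℂ} (hq : ‖q‖ < 1) (n k : ℕ) :
    (q ^ k - q ^ (n + 1)) * qBinomCoeff e q (n + 1) k
      = (q ^ k - e * q ^ n) * qBinomCoeff e q n k := by
  rcases lt_trichotomy k (n + 1) with h | rfl | h
  · obtain ⟨m, rfl⟩ := Nat.exists_eq_add_of_le (Nat.lt_succ_iff.1 h)
    have h0 := qShift_ne_zero_of_norm_lt_one hq hq (m + 1)
    rw [qShift_succ] at h0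
    have h1 := left_ne_zero_of_mul h0
    have h2 := right_ne_zero_of_mul h0
    have e1 : k + m + 1 - k = m + 1 := by omega
    rw [qBinomCoeff, qBinomCoeff, if_pos (by omega), if_pos (by omega), e1,
      Nat.add_sub_cancel_left, qShift_succ, qShift_succ, mul_div_mul_comm, pow_succ, pow_add]
    have h3 : q ^ k - q ^ k * q ^ m * q = q ^ k * (1 - q * q ^ m) := by ring
    rw [h3]
    generalize 1 - q * q ^ m = w at *
    field_simp
  · simp [qBinomCoeff]
  · rw [qBinomCoeff, qBinomCoeff, if_neg (by omega), if_neg (by omega)]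
    simp

theorem invQFact_eq (q : ℂ) (n k : ℕ) : invQFact q n k = qBinomCoeff 0 q n k := by
  simp [invQFact, qBinomCoeff, qShift]

theorem invQFact_succ_left {q : ℂ} (hq : ‖q‖ < 1) (n k : ℕ) :
    (q ^ k - q ^ (n + 1)) * invQFact q (n + 1) k = q ^ k * invQFact q n k := by
  simpa [invQFact_eq] using qBinomCoeff_succ_left 0 hq n k

/-- The `q`-Pfaff–Saalschütz sum. -/
theorem qSaalschuetz {q : ℂ} (hq0 : q ≠ 0) (hq : ‖q‖ < 1) (A B e : ℂ)
    (hC : ∀ k : ℕ, A * B * e * q ^ k ≠ 1) (n : ℕ) :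
    ∑ m ∈ Finset.range (n + 1), qShift A q m * qShift B q m * e ^ m * qBinomCoeff e q n m
        / (qShift q q m * qShift (A * B * e) q m)
      = qShift (A * e) q n * qShift (B * e) q n / (qShift q q n * qShift (A * B * e) q n) := by
  set t : ℕ → ℕ → ℂ := fun n m => qShift A q m * qShift B q m * e ^ m * qBinomCoeff e q n m
        / (qShift q q m * qShift (A * B * e) q m) with ht
  have hC' := qShift_ne_zero hC
  have hQ' := qShift_ne_zero_of_norm_lt_one hq hq
  have fC : ∀ k : ℕ, 1 - A * B * e * q ^ k ≠ 0 := fun k => sub_ne_zero.2 (hC k).symm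
  have fQ : ∀ k : ℕ, 1 - q * q ^ k ≠ 0 := fun k =>
    sub_ne_zero.2 (mul_pow_ne_one_of_norm_lt_one hq hq k).symm
  induction n with
  | zero => simp [qShift_zero, qBinomCoeff]
  | succ n ih =>
    -- Telescoping certificate: a rational multiple of the summand for n + 1. The factor 1 - q^m
    -- kills it at m = 0, the cutoff at m = n + 2.
    set G : ℕ → ℂ := fun m => -(q * q ^ n / q ^ m) * (1 - q ^ m) * (1 - A * B * e * q ^ m / q)
      * (qShift A q m * qShift B q m * e ^ m * qBinomCoeff e q (n + 1) m
        / (qShift q q m * qShift (A * B * e) q m)) with hG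
    have step : ∀ m, (1 - q * q ^ n) * (1 - A * B * e * q ^ n) * t (n + 1) m
        - (1 - A * e * q ^ n) * (1 - B * e * q ^ n) * t n m = G (m + 1) - G m := by
      intro m
      have hm := pow_ne_zero m hq0
      have h1 := qBinomCoeff_succ_left e hq n m
      simp only [ht, hG, qBinomCoeff_succ_succ, qShift_succ, pow_succ] at h1 ⊢
      have a1 := hC' m
      have a2 := hQ' m
      have a3 := fC m
      have a4 := fQ m
      generalize qBinomCoeff e q (n + 1) m = y1 at *
      generalize qBinomCoeff e q n m = y0 at *
      generalize q ^ m = K at *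
      generalize q ^ n = Q at *
      generalize qShift A q m = SA at *
      generalize qShift B q m = SB at *
      generalize qShift q q m = SQ at *
      generalize qShift (A * B * e) q m = SC at *
      generalize e ^ m = E at *
      have e1 : 1 - A * B * e * (K * q) / q = 1 - A * B * e * K := by field_simp
      have e2 : q * Q / (K * q) = Q / K := by field_simp
      rw [e1, e2, mul_comm K q]
      generalize 1 - A * B * e * K = W at *
      generalize 1 - q * K = Z at *
      field_simp
      linear_combination (SA * SB * E * (1 - Q * A * B * e * K)) * h1
    have tel : (1 - q * q ^ n) * (1 - A * B * e * q ^ n) * ∑ m ∈ Finset.range (n + 2), t (n + 1) m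
        = (1 - A * e * q ^ n) * (1 - B * e * q ^ n) * ∑ m ∈ Finset.range (n + 1), t n m := by
      have h1 := Finset.sum_range_sub G (n + 2)
      have h2 : G 0 = 0 := by simp [hG]
      have h3 : G (n + 2) = 0 := by simp [hG, qBinomCoeff]
      -- The zero convention lets both sums run over the same range.
      have h4 : t n (n + 1) = 0 := by simp [ht, qBinomCoeff]
      rw [h2, h3, sub_zero] at h1
      simp only [← step] at h1
      rw [Finset.sum_sub_distrib, ← Finset.mul_sum, ← Finset.mul_sum,
        Finset.sum_range_succ (t n) (n + 1), h4, add_zero] at h1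
      exact sub_eq_zero.1 h1
    rw [ih] at tel
    have a1 := hC' n
    have a2 := hQ' n
    have a3 := fC n
    have a4 := fQ n
    rw [qShift_succ, qShift_succ, qShift_succ, qShift_succ, eq_div_iff (by simp_all)]
    rw [← mul_div_assoc, eq_div_iff (by simp_all)] at tel
    linear_combination tel

/-- The summand of the very-well-poised `₆φ₅` series in its limiting form. -/
def wellPoisedTerm (q α u v : ℂ) (k : ℕ) : ℂ :=
  (1 - α * q ^ (2 * k)) * (qShift α q k * qShift (q / u) q k * qShift (q / v) q k)
    / ((1 - α) * (qShift q q k * qShift (α * u) q k * qShift (α * v) q k))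
    * (-(α * u * v / q)) ^ k * q ^ (k * (k - 1) / 2)

/-- Rogers' terminating `₆φ₅` sum. -/
theorem terminating_sixPhiFive {q : ℂ} (hq0 : q ≠ 0) (hq : ‖q‖ < 1) {α u v : ℂ} (hu : u ≠ 0)
    (hv : v ≠ 0) (hα : ∀ k : ℕ, α * q ^ k ≠ 1) (hαu : ∀ k : ℕ, α * u * q ^ k ≠ 1)
    (hαv : ∀ k : ℕ, α * v * q ^ k ≠ 1) (n : ℕ) :
    ∑ k ∈ Finset.range (n + 1), wellPoisedTerm q α u v k * invQFact q n k
        / qShift (α * q) q (n + k)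
      = qShift (α * u * v / q) q n
        / (qShift q q n * qShift (α * u) q n * qShift (α * v) q n) := by
  have hu' := qShift_ne_zero hαu
  have hv' := qShift_ne_zero hαv
  have hQ' := qShift_ne_zero_of_norm_lt_one hq hq
  have hαq : ∀ k : ℕ, α * q * q ^ k ≠ 1 := fun k => by
    rw [mul_assoc, ← pow_succ']; exact hα (k + 1)
  have hα' := qShift_ne_zero hαq
  have fu : ∀ k : ℕ, 1 - α * u * q ^ k ≠ 0 := fun k => sub_ne_zero.2 (hαu k).symm
  have fv : ∀ k : ℕ, 1 - α * v * q ^ k ≠ 0 := fun k => sub_ne_zero.2 (hαv k).symm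
  have fα : ∀ k : ℕ, 1 - α * q * q ^ k ≠ 0 := fun k => sub_ne_zero.2 (hαq k).symm
  have fQ : ∀ k : ℕ, 1 - q * q ^ k ≠ 0 := fun k =>
    sub_ne_zero.2 (mul_pow_ne_one_of_norm_lt_one hq hq k).symm
  have h1α : 1 - α ≠ 0 := by simpa using sub_ne_zero.2 (hα 0).symm
  set t : ℕ → ℕ → ℂ := fun n k => wellPoisedTerm q α u v k * invQFact q n k
        / qShift (α * q) q (n + k) with ht
  induction n with
  | zero => simp [qShift_zero, invQFact, wellPoisedTerm, h1α]
  | succ n ih =>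
    -- Again a certificate: the very-well-poised factor 1 - αq^{2k} is dropped, and the denominator
    -- is (αq)_{n+k} rather than (αq)_{n+1+k}.
    set G : ℕ → ℂ := fun k => -(q * q ^ n / q ^ k) * (1 - q ^ k) * (1 - α * u * q ^ k / q)
      * (1 - α * v * q ^ k / q) * ((qShift α q k * qShift (q / u) q k * qShift (q / v) q k)
      / ((1 - α) * (qShift q q k * qShift (α * u) q k * qShift (α * v) q k))
      * (-(α * u * v / q)) ^ k * q ^ (k * (k - 1) / 2)) * invQFact q (n + 1) k
      / qShift (α * q) q (n + k) with hG
    have step : ∀ k, (1 - q * q ^ n) * (1 - α * u * q ^ n) * (1 - α * v * q ^ n) * t (n + 1) k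
        - (1 - α * u * v / q * q ^ n) * t n k = G (k + 1) - G k := by
      intro k
      have hm := pow_ne_zero k hq0
      have h1 := invQFact_succ_left hq n k
      have htri : (k + 1) * (k + 1 - 1) / 2 = k * (k - 1) / 2 + k := Nat.triangle_succ k
      have hnk : n + 1 + k = n + k + 1 := by ring
      have hnk' : n + (k + 1) = n + k + 1 := by ring
      simp only [ht, hG, wellPoisedTerm, invQFact_succ_succ, htri, hnk, hnk', qShift_succ] at h1 ⊢
      simp only [pow_succ, pow_add, pow_mul', pow_zero, one_mul] at h1 ⊢
      have a1 := hu' k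
      have a2 := hv' k
      have a3 := hα' (n + k)
      have a4 := hQ' k
      have b1 := fu k
      have b2 := fv k
      have b3 := fα (n + k)
      have b4 := fQ k
      rw [pow_add] at b3
      generalize qShift (α * q) q (n + k) = SN at *
      generalize invQFact q (n + 1) k = y1 at *
      generalize invQFact q n k = y0 at *
      generalize q ^ (k * (k - 1) / 2) = T at *
      generalize (-(α * u * v / q)) ^ k = P at *
      generalize q ^ k = K at *
      generalize q ^ n = Q at *
      generalize qShift α q k = SA at *
      generalize qShift (q / u) q k = SU at *
      generalize qShift (q / v) q k = SV at *
      generalize qShift q q k = SQ at *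
      generalize qShift (α * u) q k = Su at *
      generalize qShift (α * v) q k = Sv at *
      have e1 : 1 - α * u * (K * q) / q = 1 - α * u * K := by field_simp
      have e2 : 1 - α * v * (K * q) / q = 1 - α * v * K := by field_simp
      have e3 : q * Q / (K * q) = Q / K := by field_simp
      have e4 : 1 - α * q * (Q * K) ≠ 0 := b3
      rw [e1, e2, e3, mul_comm K q]
      generalize 1 - α * u * K = W1 at *
      generalize 1 - α * v * K = W2 at *
      generalize 1 - q * K = Z at *
      have h2 : y0 = (K - Q * q) / K * y1 := by field_simp; linear_combination -h1
      subst h2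
      -- Opaque names keep these factors as atoms while denominators are cleared; only D has to be
      -- expanded afterwards.
      obtain ⟨D, hD⟩ : ∃ D, D = 1 - α * q * (Q * K) := ⟨_, rfl⟩
      obtain ⟨E, hE⟩ : ∃ E, E = 1 - α := ⟨_, rfl⟩
      rw [← hE] at h1α
      rw [← hD] at e4
      rw [← hD, ← hE]
      field_simp
      rw [hD]
      ring
    have tel : (1 - q * q ^ n) * (1 - α * u * q ^ n) * (1 - α * v * q ^ n)
          * ∑ m ∈ Finset.range (n + 2), t (n + 1) m
        = (1 - α * u * v / q * q ^ n) * ∑ m ∈ Finset.range (n + 1), t n m := by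
      have h1 := Finset.sum_range_sub G (n + 2)
      have h2 : G 0 = 0 := by simp [hG]
      have h3 : G (n + 2) = 0 := by simp [hG, invQFact]
      have h4 : t n (n + 1) = 0 := by simp [ht, invQFact]
      rw [h2, h3, sub_zero] at h1
      simp only [← step] at h1
      rw [Finset.sum_sub_distrib, ← Finset.mul_sum, ← Finset.mul_sum,
        Finset.sum_range_succ (t n) (n + 1), h4, add_zero] at h1
      exact sub_eq_zero.1 h1
    rw [ih] at tel
    have a1 := hu' n
    have a2 := hv' n
    have a3 := hQ' n
    have b1 := fu n
    have b2 := fv n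
    have b3 := fQ n
    rw [qShift_succ, qShift_succ, qShift_succ, qShift_succ, eq_div_iff (by simp_all)]
    rw [← mul_div_assoc, eq_div_iff (by simp_all)] at tel
    linear_combination tel

/-! ### The q-Gauss sum. -/

/-- The summand of the `q`-Gauss series `₂φ₁(A, B; ABz; q, z)`. -/
def qGaussTerm (q A B z : ℂ) (n : ℕ) : ℂ :=
  qShift A q n * qShift B q n * z ^ n / (qShift q q n * qShift (A * B * z) q n)

theorem isBoundedFamily_qGaussTerm_coeff {q : ℂ} (hq : ‖q‖ < 1) (A B : ℂ) :
    IsBoundedFamily fun n => qShift A q n * qShift B q n * (qShift q q n)⁻¹ :=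
  ((IsBoundedFamily.qShift A hq).mul (.qShift B hq)).mul
    (.inv_qShift hq (mul_pow_ne_one_of_norm_lt_one hq hq))

theorem summable_qGaussTerm {q A B z : ℂ} (hq : ‖q‖ < 1) (hz : ‖z‖ < 1)
    (hC : ∀ k : ℕ, A * B * z * q ^ k ≠ 1) : Summable (qGaussTerm q A B z) := by
  refine (((isBoundedFamily_qGaussTerm_coeff hq A B).mul (.inv_qShift hq hC)).summable_mul
    (summable_geometric_of_norm_lt_one hz)).congr fun n => ?_
  simp only [qGaussTerm, div_eq_mul_inv, mul_inv]
  ring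

/-- The lower parameter ABz moves with z, so the series at z and at zq are contiguous. The termwise
difference telescopes through `G`, which vanishes at 0 and tends to 0. -/
theorem tsum_qGaussTerm_step {q A B z : ℂ} (hq : ‖q‖ < 1) (hz : ‖z‖ < 1)
    (hC : ∀ k : ℕ, A * B * z * q ^ k ≠ 1) :
    (1 - z) * (1 - A * B * z) * ∑' n, qGaussTerm q A B z n
      = (1 - A * z) * (1 - B * z) * ∑' n, qGaussTerm q A B (z * q) n := by
  have hCq : ∀ k : ℕ, A * B * (z * q) * q ^ k ≠ 1 := fun k => by
    have := hC (k + 1); rwa [pow_succ', ← mul_assoc, mul_assoc (A * B)] at this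
  have hzq : ‖z * q‖ < 1 := by
    rw [norm_mul]; nlinarith [norm_nonneg z, norm_nonneg q]
  set w : ℕ → ℂ := fun n => qShift A q n * qShift B q n * (qShift q q n)⁻¹
    * (qShift (A * B * (z * q)) q n)⁻¹ * z ^ n with hw
  have hws : Summable w := ((isBoundedFamily_qGaussTerm_coeff hq A B).mul
    (.inv_qShift hq hCq)).summable_mul (summable_geometric_of_norm_lt_one hz)
  set G : ℕ → ℂ := fun n => w n * ((1 - q ^ n) * (1 - A * B * z * q ^ n)) with hG
  have step : ∀ n, (1 - z) * (1 - A * B * z) * qGaussTerm q A B z n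
      - (1 - A * z) * (1 - B * z) * qGaussTerm q A B (z * q) n = G n - G (n + 1) := by
    intro n
    have hQ := qShift_ne_zero_of_norm_lt_one hq hq n
    have hC1 := qShift_ne_zero hCq n
    have fC := sub_ne_zero.2 (hCq n).symm
    have fC' := sub_ne_zero.2 (hC n).symm
    have fC0 := sub_ne_zero.2 (hC 0).symm
    have fQ := sub_ne_zero.2 (mul_pow_ne_one_of_norm_lt_one hq hq n).symm
    have key : qShift (A * B * z) q n * (1 - A * B * z * q ^ n)
        = (1 - A * B * z) * qShift (A * B * (z * q)) q n := by
      rw [← qShift_succ, add_comm, qShift_add]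
      simp [qShift, mul_assoc]
    have hS : qShift (A * B * z) q n
        = (1 - A * B * z) * qShift (A * B * (z * q)) q n / (1 - A * B * z * q ^ n) := by
      rw [← key, mul_div_cancel_right₀ _ fC']
    rw [pow_zero, mul_one] at fC0
    simp only [hG, hw, qGaussTerm, hS, qShift_succ, mul_pow, pow_succ]
    have e1 : 1 - A * B * z * (q ^ n * q) = 1 - A * B * (z * q) * q ^ n := by ring
    have e2 : 1 - q ^ n * q = 1 - q * q ^ n := by ring
    rw [e1, e2]
    generalize qShift (A * B * (z * q)) q n = S at *
    generalize qShift q q n = SQ at *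
    generalize z ^ n = Z at *
    generalize q ^ n = Q at *
    generalize 1 - A * B * (z * q) * Q = D1 at *
    generalize 1 - q * Q = D2 at *
    obtain ⟨D3, hD3⟩ : ∃ D, D = 1 - A * B * z * Q := ⟨_, rfl⟩
    obtain ⟨D4, hD4⟩ : ∃ D, D = 1 - A * B * z := ⟨_, rfl⟩
    rw [← hD3] at fC'
    rw [← hD4] at fC0
    rw [← hD3, ← hD4]
    field_simp
    rw [hD3]
    ring
  have hGlim : Tendsto G atTop (𝓝 0) := by
    have hp := tendsto_pow_atTop_nhds_zero_of_norm_lt_one hq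
    have := hws.tendsto_atTop_zero.mul ((hp.const_sub 1).mul ((hp.const_mul (A * B * z)).const_sub 1))
    simpa using this
  have hsum := (((summable_qGaussTerm hq hz hC).hasSum.mul_left ((1 - z) * (1 - A * B * z))).sub
    ((summable_qGaussTerm hq hzq hCq).hasSum.mul_left ((1 - A * z) * (1 - B * z)))).tendsto_sum_nat
  simp only [step, Finset.sum_range_sub'] at hsum
  have h2 := tendsto_nhds_unique hsum (hGlim.const_sub (G 0))
  have h0 : G 0 = 0 := by simp [hG]
  rw [h0, sub_zero] at h2
  exact sub_eq_zero.1 h2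

theorem tsum_qGaussTerm_iterate {q A B z : ℂ} (hq : ‖q‖ < 1) (hz : ‖z‖ < 1)
    (hC : ∀ k : ℕ, A * B * z * q ^ k ≠ 1) (n : ℕ) :
    qShift z q n * qShift (A * B * z) q n * ∑' k, qGaussTerm q A B z k
      = qShift (A * z) q n * qShift (B * z) q n * ∑' k, qGaussTerm q A B (z * q ^ n) k := by
  induction n with
  | zero => simp [qShift_zero]
  | succ n ih =>
    have hzn : ‖z * q ^ n‖ < 1 := by
      rw [norm_mul, norm_pow]
      have : ‖q‖ ^ n ≤ 1 := pow_le_one₀ (norm_nonneg _) hq.le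
      nlinarith [norm_nonneg z, norm_nonneg q]
    have h := tsum_qGaussTerm_step hq hzn (A := A) (B := B) fun k => by
      rw [← mul_assoc, mul_assoc, ← pow_add]; exact hC _
    rw [mul_assoc z, ← pow_succ] at h
    simp only [qShift_succ]
    linear_combination (1 - z * q ^ n) * (1 - A * B * z * q ^ n) * ih
      + qShift (A * z) q n * qShift (B * z) q n * h

/-- The `q`-Gauss sum. -/
theorem tsum_qGaussTerm {q A B z : ℂ} (hq : ‖q‖ < 1) (hz : ‖z‖ < 1)
    (hC : ∀ k : ℕ, A * B * z * q ^ k ≠ 1) :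
    ∑' n, qGaussTerm q A B z n
      = qShiftInf (A * z) q * qShiftInf (B * z) q
        / (qShiftInf z q * qShiftInf (A * B * z) q) := by
  have hlim : Tendsto (fun n : ℕ => ∑' k, qGaussTerm q A B (z * q ^ n) k) atTop (𝓝 1) := by
    have h1 : ∑' k, qGaussTerm q A B 0 k = 1 := by
      rw [tsum_eq_single 0 fun k hk => by simp [qGaussTerm, hk]]
      simp [qGaussTerm, qShift_zero]
    rw [← h1]
    obtain ⟨M, hM⟩ := isBoundedFamily_qGaussTerm_coeff hq A B
    obtain ⟨N, hN⟩ := (IsBoundedFamily.qShift (A * B * z) hq)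
    obtain ⟨N', hN'⟩ := (IsBoundedFamily.inv_qShift hq hC)
    refine tendsto_tsum_of_dominated_convergence (bound := fun k => M * (N * N') * ‖z‖ ^ k)
      ((summable_geometric_of_lt_one (norm_nonneg z) hz).mul_left _) (fun k => ?_)
      (Eventually.of_forall fun n k => ?_)
    · have hp : Tendsto (fun n : ℕ => z * q ^ n) atTop (𝓝 0) := by
        simpa using (tendsto_pow_atTop_nhds_zero_of_norm_lt_one hq).const_mul z
      -- Continuity is needed only at w = 0, where the lower parameter is 0 and its shifted
      -- factorial is 1.
      have hc : ContinuousAt (fun w => qGaussTerm q A B w k) 0 := by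
        unfold qGaussTerm
        refine ContinuousAt.div ?_ ?_ ?_
        · fun_prop
        · unfold qShift; fun_prop
        · have := qShift_ne_zero_of_norm_lt_one hq hq k
          simpa [qShift] using this
      exact hc.tendsto.comp hp
    -- Writing 1/(ABzq^n)_k as (ABz)_n / (ABz)_{n+k} makes the bound uniform in n.
    · have e : qGaussTerm q A B (z * q ^ n) k
          = (qShift A q k * qShift B q k * (qShift q q k)⁻¹)
            * (qShift (A * B * z) q n * (qShift (A * B * z) q (n + k))⁻¹)
            * (z ^ k * (q ^ n) ^ k) := by
        have h2 := qShift_ne_zero hC n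
        rw [qShift_add, qGaussTerm, mul_inv, mul_inv_cancel_left₀ h2, mul_pow, div_eq_mul_inv,
          mul_inv, ← mul_assoc (A * B)]
        ring
      rw [e, norm_mul, norm_mul, norm_mul (qShift (A * B * z) q n)]
      have hM0 := (norm_nonneg _).trans (hM 0)
      have hN0 := (norm_nonneg _).trans (hN 0)
      have hN0' := (norm_nonneg _).trans (hN' 0)
      refine mul_le_mul (mul_le_mul (hM k) (mul_le_mul (hN n) (hN' _) (norm_nonneg _) hN0)
        (by positivity) hM0) ?_ (norm_nonneg _) (by positivity)
      rw [norm_mul, norm_pow, norm_pow, norm_pow]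
      exact mul_le_of_le_one_right (by positivity)
        (pow_le_one₀ (by positivity) (pow_le_one₀ (norm_nonneg _) hq.le))
  have h1 := (((tendsto_qShift z hq).mul (tendsto_qShift (A * B * z) hq)).mul_const
    (∑' k, qGaussTerm q A B z k))
  have h2 := ((tendsto_qShift (A * z) hq).mul (tendsto_qShift (B * z) hq)).mul hlim
  simp only [tsum_qGaussTerm_iterate hq hz hC] at h1
  have h3 := tendsto_nhds_unique h1 h2
  have n1 := qShiftInf_ne_zero hq (mul_pow_ne_one_of_norm_lt_one hq hz)
  have n2 := qShiftInf_ne_zero hq hC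
  rw [eq_div_iff (mul_ne_zero n1 n2)]
  linear_combination h3

/-! ### Antidiagonal summation and the double series free of u and v. -/

theorem summable_sum_antidiagonal {f : ℕ × ℕ → ℂ} (hf : Summable f) :
    Summable fun n => ∑ p ∈ Finset.HasAntidiagonal.antidiagonal n, f p := by
  have := ((Finset.HasAntidiagonal.sigmaAntidiagonalEquivProd (A := ℕ)).summable_iff.2 hf).sigma
  refine this.congr fun n => ?_
  rw [tsum_fintype]
  exact (Finset.sum_coe_sort (Finset.HasAntidiagonal.antidiagonal n) f)

theorem tsum_sum_antidiagonal {f : ℕ × ℕ → ℂ} (hf : Summable f) :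
    ∑' n, ∑ p ∈ Finset.HasAntidiagonal.antidiagonal n, f p = ∑' p, f p := by
  have h := ((Finset.HasAntidiagonal.sigmaAntidiagonalEquivProd (A := ℕ)).summable_iff.2 hf).tsum_sigma
  rw [← (Finset.HasAntidiagonal.sigmaAntidiagonalEquivProd (A := ℕ)).tsum_eq f]
  refine Eq.trans (tsum_congr fun n => ?_) h.symm
  rw [tsum_fintype]
  exact (Finset.sum_coe_sort (Finset.HasAntidiagonal.antidiagonal n) f).symm

theorem norm_mul_lt_one {x y : ℂ} (hx : ‖x‖ < 1) (hy : ‖y‖ < 1) : ‖x * y‖ < 1 := by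
  rw [norm_mul]; nlinarith [norm_nonneg x, norm_nonneg y]

/-- The summand of the double series obtained by expanding the inner `₃φ₂`. -/
def innerTerm (q a b c d r : ℂ) (p : ℕ × ℕ) : ℂ :=
  qShift (a * b) q (p.1 + p.2) * qShift (a * c) q (p.1 + p.2) * qShift (a * d) q p.1
    * qShift (a * r) q p.1 * qShift (b * c) q p.2
    * (qShift (a * b * c * d) q (p.1 + p.2))⁻¹ * (qShift (a * b * c * r) q (p.1 + p.2))⁻¹
    * (qShift q q p.1)⁻¹ * (qShift q q p.2)⁻¹ * (qShift (a ^ 2 * b * c * d * r) q p.1)⁻¹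
    * ((b * c * d * r) ^ p.1 * (d * r) ^ p.2)

theorem summable_innerTerm {q a b c d r : ℂ} (hq : ‖q‖ < 1) (ha : ‖a‖ < 1) (hb : ‖b‖ < 1)
    (hc : ‖c‖ < 1) (hd : ‖d‖ < 1) (hr : ‖r‖ < 1) : Summable (innerTerm q a b c d r) := by
  have h2 : ∀ {x : ℂ}, ‖x‖ < 1 → IsBoundedFamily fun n => (qShift x q n)⁻¹ := fun hx =>
    .inv_qShift hq (mul_pow_ne_one_of_norm_lt_one hq hx)
  have hm := @norm_mul_lt_one
  have e : a ^ 2 * b * c * d * r = a * a * b * c * d * r := by ring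
  have h1 : ∀ {x : ℂ}, IsBoundedFamily (qShift x q) := .qShift _ hq
  have hab := h1 (x := a * b) |>.comp fun p : ℕ × ℕ => p.1 + p.2
  have hac := h1 (x := a * c) |>.comp fun p : ℕ × ℕ => p.1 + p.2
  have had := h1 (x := a * d) |>.comp fun p : ℕ × ℕ => p.1
  have har := h1 (x := a * r) |>.comp fun p : ℕ × ℕ => p.1
  have hbc := h1 (x := b * c) |>.comp fun p : ℕ × ℕ => p.2
  have habcd := h2 (hm (hm (hm ha hb) hc) hd) |>.comp fun p : ℕ × ℕ => p.1 + p.2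
  have habcr := h2 (hm (hm (hm ha hb) hc) hr) |>.comp fun p : ℕ × ℕ => p.1 + p.2
  have hq1 := h2 hq |>.comp fun p : ℕ × ℕ => p.1
  have hq2 := h2 hq |>.comp fun p : ℕ × ℕ => p.2
  have hα := h2 (hm (hm (hm (hm (hm ha ha) hb) hc) hd) hr) |>.comp fun p : ℕ × ℕ => p.1
  rw [← e] at hα
  exact (((((((((hab.mul hac).mul had).mul har).mul hbc).mul habcd).mul habcr).mul hq1).mul
    hq2).mul hα).summable_mul (summable_mul_of_summable_norm
      (summable_geometric_of_norm_lt_one (hm (hm (hm hb hc) hd) hr)).norm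
      (summable_geometric_of_norm_lt_one (hm hd hr)).norm)

/-- On p.1 + p.2 = n the sum is q-Saalschütz with parameters ad, ar, bc. Its numerator (abcd)_n
(abcr)_n cancels the denominators, leaving the q-Gauss series with parameters ab, ac and argument
dr. -/
theorem tsum_innerTerm {q a b c d r : ℂ} (hq0 : q ≠ 0) (hq : ‖q‖ < 1) (ha : ‖a‖ < 1) (hb : ‖b‖ < 1)
    (hc : ‖c‖ < 1) (hd : ‖d‖ < 1) (hr : ‖r‖ < 1) :
    ∑' p, innerTerm q a b c d r p
      = qShiftInf (a * b * d * r) q * qShiftInf (a * c * d * r) q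
        / (qShiftInf (d * r) q * qShiftInf (a ^ 2 * b * c * d * r) q) := by
  have hm := @norm_mul_lt_one
  have hC : ‖a * b * (a * c) * (d * r)‖ < 1 := hm (hm (hm ha hb) (hm ha hc)) (hm hd hr)
  have hC' : ‖a * d * (a * r) * (b * c)‖ < 1 := hm (hm (hm ha hd) (hm ha hr)) (hm hb hc)
  have e1 : a * b * (a * c) * (d * r) = a ^ 2 * b * c * d * r := by ring
  have e2 : a * d * (a * r) * (b * c) = a ^ 2 * b * c * d * r := by ring
  have e3 : a * d * (b * c) = a * b * c * d := by ring
  have e4 : a * r * (b * c) = a * b * c * r := by ring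
  have e5 : a * b * (d * r) = a * b * d * r := by ring
  have e6 : a * c * (d * r) = a * c * d * r := by ring
  have hG := tsum_qGaussTerm (A := a * b) (B := a * c) hq (hm hd hr)
    (mul_pow_ne_one_of_norm_lt_one hq hC)
  rw [e1, e5, e6] at hG
  rw [← hG, ← tsum_sum_antidiagonal (summable_innerTerm hq ha hb hc hd hr)]
  refine tsum_congr fun n => ?_
  have hS := qSaalschuetz hq0 hq (a * d) (a * r) (b * c) (mul_pow_ne_one_of_norm_lt_one hq hC') n
  rw [e2, e3, e4] at hS
  have n1 := qShift_ne_zero_of_norm_lt_one hq (hm (hm (hm ha hb) hc) hd) n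
  have n2 := qShift_ne_zero_of_norm_lt_one hq (hm (hm (hm ha hb) hc) hr) n
  rw [Finset.Nat.sum_antidiagonal_eq_sum_range_succ_mk]
  have key : ∀ m ∈ Finset.range (n + 1), innerTerm q a b c d r (m, n - m)
      = qShift (a * b) q n * qShift (a * c) q n * (qShift (a * b * c * d) q n)⁻¹
        * (qShift (a * b * c * r) q n)⁻¹ * (d * r) ^ n
        * (qShift (a * d) q m * qShift (a * r) q m * (b * c) ^ m * qBinomCoeff (b * c) q n m
        / (qShift q q m * qShift (a ^ 2 * b * c * d * r) q m)) := by
    intro m hm'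
    have hmn : m ≤ n := Nat.lt_succ_iff.1 (Finset.mem_range.1 hm')
    have ep : (b * c * d * r) ^ m * (d * r) ^ (n - m) = (b * c) ^ m * (d * r) ^ n := by
      obtain ⟨j, rfl⟩ := Nat.exists_eq_add_of_le hmn
      rw [Nat.add_sub_cancel_left, pow_add, ← mul_assoc, ← mul_pow]
      ring
    simp only [innerTerm, ep, Nat.add_sub_cancel' hmn, qBinomCoeff, if_pos hmn, div_eq_mul_inv,
      mul_inv]
    ring
  rw [Finset.sum_congr rfl key, ← Finset.mul_sum, hS, qGaussTerm, e1]
  field_simp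

/-! ### The triple series and its two evaluations. -/

/-- The ratio of consecutive terms is P q^k, which tends to 0 for every P; hence no bound on u or v
is required. -/
theorem summable_pow_mul_pow_triangle {q : ℂ} (hq : ‖q‖ < 1) (P : ℂ) :
    Summable fun k : ℕ => P ^ k * q ^ (k * (k - 1) / 2) := by
  refine summable_of_ratio_norm_eventually_le (r := 1 / 2) (by norm_num) ?_
  have h : Tendsto (fun k : ℕ => ‖P * q ^ k‖) atTop (𝓝 0) := by
    simpa using ((tendsto_pow_atTop_nhds_zero_of_norm_lt_one hq).const_mul P).norm
  filter_upwards [h.eventually (ge_mem_nhds (show (0 : ℝ) < 1 / 2 by norm_num))] with k hk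
  have htri : (k + 1) * (k + 1 - 1) / 2 = k * (k - 1) / 2 + k := Nat.triangle_succ k
  rw [htri, pow_succ, pow_add,
    show P ^ k * P * (q ^ (k * (k - 1) / 2) * q ^ k)
      = P * q ^ k * (P ^ k * q ^ (k * (k - 1) / 2)) by ring, norm_mul]
  exact mul_le_mul_of_nonneg_right hk (norm_nonneg _)

theorem summable_wellPoisedTerm {q α u v : ℂ} (hq : ‖q‖ < 1)
    (hαu : ∀ k : ℕ, α * u * q ^ k ≠ 1) (hαv : ∀ k : ℕ, α * v * q ^ k ≠ 1) :
    Summable (wellPoisedTerm q α u v) := by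
  have h1 : IsBoundedFamily fun k : ℕ => 1 - α * q ^ (2 * k) := by
    have := ((tendsto_pow_atTop_nhds_zero_of_norm_lt_one hq).const_mul α).const_sub 1
    exact (IsBoundedFamily.of_tendsto this).comp fun k : ℕ => 2 * k
  have h := ((((((h1.mul (.qShift α hq)).mul (.qShift (q / u) hq)).mul (.qShift (q / v) hq)).mul
    (.const (1 - α)⁻¹)).mul (.inv_qShift hq (mul_pow_ne_one_of_norm_lt_one hq hq))).mul
    (.inv_qShift hq hαu)).mul (.inv_qShift hq hαv)
  refine (h.summable_mul (summable_pow_mul_pow_triangle hq (-(α * u * v / q)))).congr fun k => ?_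
  simp only [wellPoisedTerm, div_eq_mul_inv, mul_inv]
  ring

theorem isBoundedFamily_pow {z : ℂ} (hz : ‖z‖ < 1) : IsBoundedFamily fun n : ℕ => z ^ n :=
  .of_tendsto (tendsto_pow_atTop_nhds_zero_of_norm_lt_one hz)

/-- The summand, at outer index `n` and inner index `j`, of the double series on which the
parameters `u` and `v` have no influence. -/
def outerTerm (q a b c d r : ℂ) (n j : ℕ) : ℂ :=
  qShift (a * b) q (n + j) * qShift (a * c) q (n + j) * qShift (a * d) q n * qShift (a * r) q n
    * qShift (b * c) q j * (qShift (a * b * c * d) q (n + j))⁻¹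
    * (qShift (a * b * c * r) q (n + j))⁻¹ * (qShift q q j)⁻¹
    * ((b * c * d * r) ^ n * (d * r) ^ j)

/-- The summand of the triple series at the index `((k, m), j)`. -/
def tripleTerm (q α a b c d r u v : ℂ) (p : (ℕ × ℕ) × ℕ) : ℂ :=
  wellPoisedTerm q α u v p.1.1 * (qShift q q p.1.2)⁻¹
    * (qShift (α * q) q (p.1.1 + p.1.2 + p.1.1))⁻¹ * outerTerm q a b c d r (p.1.1 + p.1.2) p.2

/-- Up to bounded factors the term is a product of three summable sequences: `wellPoisedTerm` times
(bcdr)^k, then (bcdr)^m, then (dr)^j. -/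
theorem summable_tripleTerm {q a b c d r : ℂ} (hq : ‖q‖ < 1) (ha : ‖a‖ < 1)
    (hb : ‖b‖ < 1) (hc : ‖c‖ < 1) (hd : ‖d‖ < 1) (hr : ‖r‖ < 1)
    {α u v : ℂ} (hα : ‖α * q‖ < 1)
    (hαu : ∀ k : ℕ, α * u * q ^ k ≠ 1) (hαv : ∀ k : ℕ, α * v * q ^ k ≠ 1) :
    Summable (tripleTerm q α a b c d r u v) := by
  have h2 : ∀ {x : ℂ}, ‖x‖ < 1 → IsBoundedFamily fun n => (qShift x q n)⁻¹ := fun hx =>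
    .inv_qShift hq (mul_pow_ne_one_of_norm_lt_one hq hx)
  have hm := @norm_mul_lt_one
  have h1 : ∀ {x : ℂ}, IsBoundedFamily (qShift x q) := .qShift _ hq
  have hab := h1 (x := a * b) |>.comp fun p : (ℕ × ℕ) × ℕ => p.1.1 + p.1.2 + p.2
  have hac := h1 (x := a * c) |>.comp fun p : (ℕ × ℕ) × ℕ => p.1.1 + p.1.2 + p.2
  have had := h1 (x := a * d) |>.comp fun p : (ℕ × ℕ) × ℕ => p.1.1 + p.1.2
  have har := h1 (x := a * r) |>.comp fun p : (ℕ × ℕ) × ℕ => p.1.1 + p.1.2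
  have hbc := h1 (x := b * c) |>.comp fun p : (ℕ × ℕ) × ℕ => p.2
  have habcd := h2 (hm (hm (hm ha hb) hc) hd) |>.comp
    fun p : (ℕ × ℕ) × ℕ => p.1.1 + p.1.2 + p.2
  have habcr := h2 (hm (hm (hm ha hb) hc) hr) |>.comp
    fun p : (ℕ × ℕ) × ℕ => p.1.1 + p.1.2 + p.2
  have hq1 := h2 hq |>.comp fun p : (ℕ × ℕ) × ℕ => p.1.2
  have hq2 := h2 hq |>.comp fun p : (ℕ × ℕ) × ℕ => p.2
  have hα' := h2 hα |>.comp fun p : (ℕ × ℕ) × ℕ => p.1.1 + p.1.2 + p.1.1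
  have hbcdr := hm (hm (hm hb hc) hd) hr
  have hW := (isBoundedFamily_pow hbcdr).summable_mul (summable_wellPoisedTerm hq hαu hαv)
  have hs := summable_mul_of_summable_norm (summable_mul_of_summable_norm hW.norm
    (summable_geometric_of_norm_lt_one hbcdr).norm).norm
    (summable_geometric_of_norm_lt_one (hm hd hr)).norm
  refine ((((((((((hab.mul hac).mul had).mul har).mul hbc).mul habcd).mul habcr).mul hq1).mul
    hq2).mul hα').summable_mul hs).congr fun p => ?_
  simp only [tripleTerm, outerTerm, pow_add]
  ring

theorem outerTerm_eq (q a b c d r : ℂ) (n j : ℕ) :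
    outerTerm q a b c d r n j
      = qShift (a * b) q n * qShift (a * c) q n * qShift (a * d) q n * qShift (a * r) q n
        * (qShift (a * b * c * d) q n)⁻¹ * (qShift (a * b * c * r) q n)⁻¹ * (b * c * d * r) ^ n
        * qHypTerm ![a * b * q ^ n, a * c * q ^ n, b * c]
          ![a * b * c * d * q ^ n, a * b * c * r * q ^ n] q (d * r) j := by
  simp only [outerTerm, qHypTerm, qShifts, Fin.prod_univ_succ, qShift_add]
  simp
  ring

theorem summable_qHypTerm_inner {q a b c d r : ℂ} (hq : ‖q‖ < 1) (ha : ‖a‖ < 1)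
    (hb : ‖b‖ < 1) (hc : ‖c‖ < 1) (hd : ‖d‖ < 1) (hr : ‖r‖ < 1)
    (n : ℕ) :
    Summable (qHypTerm ![a * b * q ^ n, a * c * q ^ n, b * c]
      ![a * b * c * d * q ^ n, a * b * c * r * q ^ n] q (d * r)) := by
  have hm := @norm_mul_lt_one
  have hs : ∀ {x : ℂ}, ‖x‖ < 1 → ∀ k : ℕ, x * q ^ n * q ^ k ≠ 1 := fun hx k => by
    rw [mul_assoc, ← pow_add]; exact mul_pow_ne_one_of_norm_lt_one hq hx _
  have h := (((((IsBoundedFamily.qShift (a * b * q ^ n) hq).mul (.qShift (a * c * q ^ n) hq)).mul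
    (.qShift (b * c) hq)).mul (.inv_qShift hq (mul_pow_ne_one_of_norm_lt_one hq hq))).mul
    (.inv_qShift hq (hs (hm (hm (hm ha hb) hc) hd)))).mul
    (.inv_qShift hq (hs (hm (hm (hm ha hb) hc) hr)))
  refine (h.summable_mul (summable_geometric_of_norm_lt_one (hm hd hr))).congr fun k => ?_
  simp [qHypTerm, qShifts, Fin.prod_univ_succ, div_eq_mul_inv]
  ring

/-- The `outerTerm` factor depends on k and m only through n = k + m, so the sum over k is exactly
the terminating ₆φ₅. -/
theorem sum_antidiagonal_tsum_tripleTerm {q : ℂ} (hq : ‖q‖ < 1) (a b c d r : ℂ)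
    (hq0 : q ≠ 0) {α u v : ℂ} (hu : u ≠ 0) (hv : v ≠ 0)
    (hα : ∀ k : ℕ, α * q ^ k ≠ 1)
    (hαu : ∀ k : ℕ, α * u * q ^ k ≠ 1) (hαv : ∀ k : ℕ, α * v * q ^ k ≠ 1) (n : ℕ) :
    ∑ p ∈ Finset.HasAntidiagonal.antidiagonal n, ∑' j, tripleTerm q α a b c d r u v (p, j)
      = doubleSeriesTerm q α a b c d r u v n := by
  have hφ := terminating_sixPhiFive hq0 hq hu hv hα hαu hαv n
  have key : ∀ k ∈ Finset.range (n + 1), ∑' j, tripleTerm q α a b c d r u v ((k, n - k), j)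
      = wellPoisedTerm q α u v k * invQFact q n k / qShift (α * q) q (n + k)
        * ∑' j, outerTerm q a b c d r n j := by
    intro k hk
    have hkn : k ≤ n := Nat.lt_succ_iff.1 (Finset.mem_range.1 hk)
    simp only [tripleTerm, Nat.add_sub_cancel' hkn, invQFact, if_pos hkn, div_eq_mul_inv,
      tsum_mul_left]
  rw [Finset.Nat.sum_antidiagonal_eq_sum_range_succ_mk, Finset.sum_congr rfl key,
    ← Finset.sum_mul, hφ]
  simp only [outerTerm_eq, tsum_mul_left, doubleSeriesTerm, qHyp, qShifts,
    Fin.prod_univ_succ]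
  simp [div_eq_mul_inv]
  ring

/-- Splitting off the first k factors (2k for αq) turns a into aq^k and leaves bc and dr alone,
since αq·q^{2k} = (aq^k)² bcdr. The remaining sum is then `tsum_innerTerm`. -/
theorem tsum_tsum_tripleTerm {q a b c d r : ℂ} (hq : ‖q‖ < 1) (ha : ‖a‖ < 1)
    (hb : ‖b‖ < 1) (hc : ‖c‖ < 1) (hd : ‖d‖ < 1) (hr : ‖r‖ < 1)
    (hq0 : q ≠ 0) {α u v : ℂ} (hα : α = a ^ 2 * b * c * d * r / q)
    (k : ℕ) :
    ∑' m, ∑' j, tripleTerm q α a b c d r u v ((k, m), j)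
      = qShiftsInf ![a * b * d * r, a * c * d * r] q / qShiftsInf ![d * r, q * α] q
        * singleSeriesTerm q α a b c d r u v k := by
  have hm := @norm_mul_lt_one
  have hA : ‖a * q ^ k‖ < 1 := by
    rw [norm_mul, norm_pow]
    have : ‖q‖ ^ k ≤ 1 := pow_le_one₀ (norm_nonneg _) hq.le
    nlinarith [norm_nonneg a, norm_nonneg q]
  have hαq : α * q = a ^ 2 * b * c * d * r := by rw [hα]; field_simp
  have hI := summable_innerTerm hq hA hb hc hd hr
  have e : ∀ m j, tripleTerm q α a b c d r u v ((k, m), j)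
      = wellPoisedTerm q α u v k * (qShift (a * b) q k * qShift (a * c) q k * qShift (a * d) q k
        * qShift (a * r) q k * (qShift (a * b * c * d) q k)⁻¹ * (qShift (a * b * c * r) q k)⁻¹
        * (qShift (α * q) q (2 * k))⁻¹ * (b * c * d * r) ^ k)
        * innerTerm q (a * q ^ k) b c d r (m, j) := by
    intro m j
    have c1 : k + m + k = 2 * k + m := by ring
    have c2 : α * q * q ^ (2 * k) = (a * q ^ k) ^ 2 * b * c * d * r := by rw [hαq]; ring
    have c3 : ∀ x, a * x * q ^ k = a * q ^ k * x := fun x => by ring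
    have c4 : ∀ x, a * b * c * x * q ^ k = a * q ^ k * b * c * x := fun x => by ring
    simp only [tripleTerm, outerTerm, innerTerm, c1, add_assoc k m, qShift_add _ _ k,
      qShift_add _ _ (2 * k), c2, c3, c4, pow_add]
    ring
  simp only [e, tsum_mul_left]
  rw [← hI.tsum_prod, tsum_innerTerm hq0 hq hA hb hc hd hr]
  -- The products at aq^k are tails of those at a: the missing segments supply (abdr)_k and (acdr)_k
  -- in the denominator, while 1/(αq)_{2k} completes 1/(αq)_∞.
  have s1 := qShiftInf_eq_mul (a * b * d * r) hq k
  have s2 := qShiftInf_eq_mul (a * c * d * r) hq k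
  have s3 := qShiftInf_eq_mul (α * q) hq (2 * k)
  have c1 : a * b * d * r * q ^ k = a * q ^ k * b * d * r := by ring
  have c2 : a * c * d * r * q ^ k = a * q ^ k * c * d * r := by ring
  have c3 : α * q * q ^ (2 * k) = (a * q ^ k) ^ 2 * b * c * d * r := by rw [hαq]; ring
  rw [c1] at s1
  rw [c2] at s2
  rw [c3] at s3
  have n1 := qShift_ne_zero_of_norm_lt_one hq (hm (hm (hm ha hb) hd) hr) k
  have n2 := qShift_ne_zero_of_norm_lt_one hq (hm (hm (hm ha hc) hd) hr) k
  have hpow : (-(α * (b * c * d * r) * u * v / q)) ^ k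
      = (-(α * u * v / q)) ^ k * (b * c * d * r) ^ k := by rw [← mul_pow]; ring
  replace s1 := (eq_div_iff n1).2 ((mul_comm _ _).trans s1.symm)
  replace s2 := (eq_div_iff n2).2 ((mul_comm _ _).trans s2.symm)
  simp only [qShiftsInf, singleSeriesTerm, wellPoisedTerm, qShifts, Fin.prod_univ_succ, hpow,
    mul_comm q α]
  simp only [Matrix.cons_val_zero, Matrix.cons_val_succ, Finset.univ_eq_empty, Finset.prod_empty,
    mul_one]
  rw [s1, s2, s3]
  simp only [div_eq_mul_inv, mul_inv]
  ring

theorem theorem6p4 (q : ℝ) (hq0 : 0 < q) (hq1 : q < 1) (α a b c d r u v : ℂ)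
    (hα : α = a ^ 2 * b * c * d * r / q)
    (ha : ‖a‖ < 1) (hb : ‖b‖ < 1) (hc : ‖c‖ < 1) (hd : ‖d‖ < 1) (hr : ‖r‖ < 1)
    (hu : u ≠ 0) (hv : v ≠ 0) (hα1 : α ≠ 1)
    (hαu : ∀ k : ℕ, α * u * (q : ℂ) ^ k ≠ 1) (hαv : ∀ k : ℕ, α * v * (q : ℂ) ^ k ≠ 1) :
    (∀ n : ℕ, Summable (qHypTerm ![a * b * (q : ℂ) ^ n, a * c * (q : ℂ) ^ n, b * c]
      ![a * b * c * d * (q : ℂ) ^ n, a * b * c * r * (q : ℂ) ^ n] q (d * r))) ∧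
    Summable (doubleSeriesTerm q α a b c d r u v) ∧
    Summable (singleSeriesTerm q α a b c d r u v) ∧
    ∑' n : ℕ, doubleSeriesTerm q α a b c d r u v n =
      qShiftsInf ![a * b * d * r, a * c * d * r] q / qShiftsInf ![d * r, q * α] q
        * ∑' n : ℕ, singleSeriesTerm q α a b c d r u v n := by
  have hqC0 : (q : ℂ) ≠ 0 := by exact_mod_cast hq0.ne'
  have hq : ‖(q : ℂ)‖ < 1 := by
    rw [Complex.norm_real, Real.norm_of_nonneg hq0.le]; exact hq1
  have hm := @norm_mul_lt_one
  have hαq : ‖α * q‖ < 1 := by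
    have e : α * q = a * a * b * c * d * r := by rw [hα]; field_simp
    rw [e]
    exact hm (hm (hm (hm (hm ha ha) hb) hc) hd) hr
  have hα' : ∀ k : ℕ, α * (q : ℂ) ^ k ≠ 1 := by
    -- Only k = 0 needs α ≠ 1; for larger k, |αq| < 1 suffices.
    rintro (_ | k)
    · simpa using hα1
    · rw [pow_succ', ← mul_assoc]
      exact mul_pow_ne_one_of_norm_lt_one hq hαq k
  have hF := summable_tripleTerm hq ha hb hc hd hr hαq hαu hαv
  have hD := sum_antidiagonal_tsum_tripleTerm hq a b c d r hqC0 hu hv hα' hαu hαv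
  have hS := tsum_tsum_tripleTerm hq ha hb hc hd hr hqC0 (u := u) (v := v) hα
  refine ⟨summable_qHypTerm_inner hq ha hb hc hd hr, ?_, ?_, ?_⟩
  · exact (summable_sum_antidiagonal hF.prod).congr hD
  -- The sums of the triple series over m and j are summable in k; dividing by the nonzero prefactor
  -- gives the single series.
  · have hC : qShiftsInf ![a * b * d * r, a * c * d * r] (q : ℂ)
        / qShiftsInf ![d * r, q * α] (q : ℂ) ≠ 0 := by
      have h0 : ∀ {x : ℂ}, ‖x‖ < 1 → qShiftInf x q ≠ 0 := fun hx =>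
        qShiftInf_ne_zero hq (mul_pow_ne_one_of_norm_lt_one hq hx)
      have h1 := h0 (hm (hm (hm ha hb) hd) hr)
      have h2 := h0 (hm (hm (hm ha hc) hd) hr)
      have h3 := h0 (hm hd hr)
      have h4 := h0 hαq
      simp [qShiftsInf, Fin.prod_univ_succ, h1, h2, h3, mul_comm (q : ℂ), h4]
    exact (summable_mul_left_iff hC).1 (hF.prod.prod.congr hS)
  · rw [← tsum_mul_left, ← tsum_congr hS, ← tsum_congr hD, tsum_sum_antidiagonal hF.prod,
      hF.prod.tsum_prod]

end
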